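/- Let \(n\) be a nonnegative integer, let \(A\) and \(B\) be subsets of \(\{0,1,\ldots,n\}\) of equal size, and let \(A^{\mathsf c}\) and \(B^{\mathsf c}\) be their complements in \(\{0,1,\ldots,n\}\). Let \(\alpha=(\alpha_1\ge\cdots\ge\alpha_n\ge 0)\) and \(\beta=(\beta_1\ge\cdots\ge\beta_n\ge 0)\) be partitions with \(n\) parts (parts equal to \(0\) permitted) such that \(\alpha_i\le\beta_i\) for all \(1\le i\le n\). Suppose that for all \(a'\in A^{\mathsf c}\) and \(b'\in B^{\mathsf c}\), at least one of the following holds: - \(a'-b'\le 0\); - \(a'-b'>\beta_{b'+1}-\alpha_{a'}\); - for all \(i\) with \(b'+1\le i\le a'\), we have \(\alpha_i-\alpha_{a'}\le a'-i\) and \(\beta_{b'+1}-\beta_i\le i-b'-1\). Let \(x_1,x_2,\ldots\) be indeterminates over a commutative ring \(R\). Then, in the polynomial ring over \(R\) in these indeterminates, \[ \det\Bigl(h_{b-a}(x_{\alpha_{a+1}+1},x_{\alpha_{a+1}+2},\ldots,x_{\beta_b})\Bigr)_{a\in A,\,b\in B} = \det\Bigl(e_{a'-b'}(x_{\alpha_{a'}+1},x_{\alpha_{a'}+2},\ldots,x_{\beta_{b'+1}})\Bigr)_{a'\in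 A^{\mathsf c},\,b'\in B^{\mathsf c}}. \] Here \(h_d\) and \(e_d\) denote the complete homogeneous and the elementary symmetric polynomials of degree \(d\) in the listed variables, with \(h_0=e_0=1\) and \(h_d=e_d=0\) for \(d<0\); the list \(x_{p+1},\ldots,x_q\) is empty if \(q\le p\), and \(h_d=e_d=0\) for \(d>0\) on an empty list. Rows and columns of each matrix are ordered from the smallest index to the largest, and the determinant of the empty matrix is \(1\). The symbols \(\alpha_0,\alpha_{n+1},\beta_0,\beta_{n+1}\) may be given arbitrary nonnegative integer values: in the hypothesis they occur only in pairs with \(a'-b'\le 0\), and in the matrices only in entries of degree at most \(0\), which do not depend on the variables. -/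

import Mathlib

namespace DetDuality

/-- The complete homogeneous symmetric polynomial `h_d(x_{p+1}, …, x_q)` of integer degree `d`
in the variables `x_j`, `p < j ≤ q` (no variables when `q ≤ p`); it is `0` for `d < 0`.
For `d ≥ 0` it is Mathlib's `MvPolynomial.hsymm` on the index set `{p+1, …, q}`, so it is `1` for
`d = 0` and `0` for `d > 0` without variables. -/
noncomputable def h (R : Type*) [CommRing R] (d : ℤ) (p q : ℕ) : MvPolynomial ℕ R :=
  if d < 0 then 0
  else MvPolynomial.rename (fun j : Finset.Ioc p q => (j : ℕ))
    (MvPolynomial.hsymm (Finset.Ioc p q) R d.toNat)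

/-- The elementary symmetric polynomial `e_d(x_{p+1}, …, x_q)` of integer degree `d`
in the variables `x_j`, `p < j ≤ q` (no variables when `q ≤ p`); it is `0` for `d < 0`.
For `d ≥ 0` it is Mathlib's `MvPolynomial.esymm` on the index set `{p+1, …, q}`, so it is `1` for
`d = 0` and `0` for `d` larger than the number of variables. -/
noncomputable def e (R : Type*) [CommRing R] (d : ℤ) (p q : ℕ) : MvPolynomial ℕ R :=
  if d < 0 then 0
  else MvPolynomial.rename (fun j : Finset.Ioc p q => (j : ℕ))
    (MvPolynomial.esymm (Finset.Ioc p q) R d.toNat)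

/-- The square matrix `(f s t)_{s ∈ S, t ∈ T}` for equinumerous sets `S`, `T ⊆ {0, …, n}`,
both ordered from the smallest element to the largest. -/
def matrixOn {M : Type*} {n : ℕ} (S T : Finset (Fin (n + 1))) (hST : S.card = T.card)
    (f : ℕ → ℕ → M) : Matrix (Fin S.card) (Fin S.card) M :=
  Matrix.of fun i j => f (S.orderEmbOfFin rfl i) (T.orderEmbOfFin hST.symm j)

theorem card_compl_eq {n : ℕ} {A B : Finset (Fin (n + 1))} (hAB : A.card = B.card) :
    Aᶜ.card = Bᶜ.card := by
  rw [Finset.card_compl, Finset.card_compl, hAB]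

/-- `α = (α_1 ≥ α_2 ≥ … ≥ α_n ≥ 0)` is a partition with `n` parts, parts equal to zero permitted.
Only the values at `1, …, n` are the parts; the other values of the function are irrelevant. -/
def IsPartition (n : ℕ) (α : ℕ → ℕ) : Prop :=
  ∀ i j : ℕ, 1 ≤ i → i ≤ j → j ≤ n → α j ≤ α i

/-- The condition on a pair of indices `a'`, `b'`: if the degree `a' - b'` is positive and does not
exceed `β_{b'+1} - α_{a'}`, then the parallelogram of boxes between rows `b' + 1` and `a'` lies
inside the skew diagram of `β/α`. All differences are differences of integers. -/
def ParallelogramCondition (α β : ℕ → ℕ) (a' b' : ℕ) : Prop :=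
  (a' : ℤ) - b' ≤ 0 ∨
  (a' : ℤ) - b' > (β (b' + 1) : ℤ) - α a' ∨
  ∀ i : ℕ, b' + 1 ≤ i → i ≤ a' →
    (α i : ℤ) - α a' ≤ (a' : ℤ) - i ∧ (β (b' + 1) : ℤ) - β i ≤ (i : ℤ) - b' - 1

end DetDuality

section

open Finset

/-! The `h` matrix over all of {0,…,n} is upper unitriangular. Jacobi's theorem therefore turns its
minor on rows A, columns B into the minor of its inverse on rows B^c, columns A^c, up to a sign. It
remains to recognise the entries of the inverse. Give row r of the skew diagram the interval (α_r,
β_r]. Because α and β are partitions, the (a,b) entry counts weakly increasing sequences with one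
term in each interval of rows a+1,…,b (`weakSum_zero_eq_h`): bounding the first term below and the
last term above bounds all of them. Up to the sign (-1)^(i+j), the (i,j) entry of the inverse counts
strictly decreasing sequences in rows i+1,…,j. Indeed, in the alternating sum of strict-then-weak
concatenations, comparing the two terms at the junction makes everything telescope
(`sum_strictSum_mul_weakSum`). Such a strict sum need not be elementary symmetric, but the
parallelogram condition makes it so (`strictSum_eq_e`). Only the entries in B^c × A^c enter the
complementary minor, so the condition is needed only there. All signs cancel, since A and A^c
together, like B and B^c, exhaust {0,…,n}. -/

/-! ### Signs of shuffles -/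

theorem Finset.sum_card_filter_lt {α : Type*} [LinearOrder α] (s : Finset α) :
    ∑ y ∈ s, #{x ∈ s | x < y} = ∑ i ∈ range #s, i := by
  induction s using Finset.induction_on_max with
  | empty => simp
  | insert a s hs ih =>
    have ha : a ∉ s := fun h => lt_irrefl _ (hs a h)
    rw [sum_insert ha, card_insert_of_notMem ha, sum_range_succ, ← ih, add_comm]
    congr 1
    · refine sum_congr rfl fun y hy => ?_
      rw [filter_insert, if_neg (hs y hy).not_gt]
    · rw [filter_insert, if_neg (lt_irrefl a), filter_true_of_mem hs]

/-- Counting inversions of the shuffle that lists a set before its complement. -/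
theorem Equiv.Perm.sign_shuffle {m k l : ℕ} (s : Finset (Fin m)) (hs : #s = k) (hsc : #sᶜ = l)
    (e₀ : Fin k ⊕ Fin l ≃ Fin m) (hl : ∀ i j, i < j → e₀ (Sum.inl i) < e₀ (Sum.inl j))
    (hr : ∀ i j, i < j → e₀ (Sum.inr i) < e₀ (Sum.inr j))
    (hlr : ∀ i j, e₀ (Sum.inl i) < e₀ (Sum.inr j)) :
    Equiv.Perm.sign (e₀.symm.trans (finSumEquivOfFinset hs hsc)) =
      (-1) ^ (∑ y ∈ s, (y : ℕ) + ∑ i ∈ range k, i) := by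
  classical
  set f := finSumEquivOfFinset hs hsc with hf
  have hinl : ∀ i, f (Sum.inl i) ∈ s := fun i => by
    rw [hf, finSumEquivOfFinset_inl]; exact orderEmbOfFin_mem _ _ _
  have hinr : ∀ i, f (Sum.inr i) ∉ s := fun i => by
    rw [hf, finSumEquivOfFinset_inr]; exact mem_compl.1 (orderEmbOfFin_mem _ _ _)
  -- The inversions are exactly the pairs x < y with x outside s and y in s.
  have key : ∀ x y : Fin m, x < y →
      (e₀ (f.symm x) < e₀ (f.symm y) ↔ ¬ (x ∉ s ∧ y ∈ s)) := by
    intro x y hxy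
    obtain ⟨u, rfl⟩ := f.surjective x
    obtain ⟨v, rfl⟩ := f.surjective y
    simp only [Equiv.symm_apply_apply]
    rcases u with i | i <;> rcases v with j | j
    · simp only [hinl, not_true_eq_false, false_and, not_false_eq_true, iff_true]
      apply hl
      simpa [hf] using hxy
    · simp only [hinl, not_true_eq_false, false_and, not_false_eq_true, iff_true]
      exact hlr _ _
    · simp only [hinl, hinr, not_false_eq_true, and_self, not_true_eq_false, iff_false, not_lt]
      exact (hlr _ _).le
    · simp only [hinr, and_false, not_false_eq_true, iff_true]
      apply hr
      simpa [hf] using hxy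
  rw [← Equiv.Perm.sign_symm, Equiv.Perm.sign_eq_prod_prod_Iio]
  have h1 : ∀ y : Fin m, (∏ x ∈ Iio y,
      (if (Equiv.symm (e₀.symm.trans f)) x < (Equiv.symm (e₀.symm.trans f)) y
        then (1 : ℤˣ) else -1)) = if y ∈ s then (-1) ^ ((y : ℕ) + #{x ∈ s | x < y}) else 1 := by
    intro y
    have h2 : ∀ x ∈ Iio y, (if (Equiv.symm (e₀.symm.trans f)) x <
        (Equiv.symm (e₀.symm.trans f)) y then (1 : ℤˣ) else -1) =
        if x ∉ s ∧ y ∈ s then -1 else 1 := by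
      intro x hx
      have := key x y (mem_Iio.1 hx)
      simp only [Equiv.symm_trans_apply, Equiv.symm_symm, this]
      split_ifs <;> simp_all
    rw [prod_congr rfl h2]
    by_cases hy : y ∈ s
    · simp only [hy, and_true, if_true]
      rw [prod_ite, prod_const, prod_const_one, mul_one]
      -- The number of inversions at y is y minus the count of smaller elements of s; modulo 2 the
      -- minus becomes a plus.
      have h3 : #{x ∈ Iio y | x ∉ s} + #{x ∈ s | x < y} = y := by
        have h4 : ({x ∈ s | x < y} : Finset (Fin m)) = {x ∈ Iio y | x ∈ s} := by
          ext x; simp [and_comm]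
        rw [h4, add_comm, card_filter_add_card_filter_not, Fin.card_Iio]
      rw [← h3, add_assoc, pow_add, ← two_mul, pow_mul]
      simp
    · simp [hy]
  rw [prod_congr rfl fun y _ => h1 y, prod_ite_mem, univ_inter, prod_pow_eq_pow_sum,
    sum_add_distrib, sum_card_filter_lt, hs]

theorem Equiv.Perm.sign_finSumEquivOfFinset {m k l : ℕ} (s t : Finset (Fin m))
    (hs : #s = k) (hsc : #sᶜ = l) (ht : #t = k) (htc : #tᶜ = l) :
    Equiv.Perm.sign ((finSumEquivOfFinset ht htc).symm.trans (finSumEquivOfFinset hs hsc)) =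
      (-1) ^ (∑ y ∈ s, (y : ℕ) + ∑ y ∈ t, (y : ℕ)) := by
  have hm : k + l = m := by
    rw [← hs, ← hsc, card_add_card_compl, Fintype.card_fin]
  set e₀ : Fin k ⊕ Fin l ≃ Fin m := finSumFinEquiv.trans (finCongr hm)
  have H := fun (s : Finset (Fin m)) (hs : #s = k) (hsc : #sᶜ = l) =>
    sign_shuffle s hs hsc e₀ (fun i j h => by simp only [e₀, Fin.lt_def] at h ⊢; simpa using h)
    (fun i j h => by simp only [e₀, Fin.lt_def] at h ⊢; simpa using h)
    (fun i j => by simp [e₀, Fin.lt_def]; omega)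
  have h1 : (finSumEquivOfFinset ht htc).symm.trans (finSumEquivOfFinset hs hsc) =
      (e₀.symm.trans (finSumEquivOfFinset ht htc)).symm.trans
        (e₀.symm.trans (finSumEquivOfFinset hs hsc)) := by
    ext x; simp
  rw [h1, sign_trans, sign_symm, H s hs hsc, H t ht htc, ← pow_add]
  -- The two shuffles contribute the same term depending on k, so it drops out modulo 2.
  have : ∑ y ∈ s, (y : ℕ) + ∑ i ∈ range k, i + (∑ y ∈ t, (y : ℕ) + ∑ i ∈ range k, i) =
    (∑ y ∈ s, (y : ℕ) + ∑ y ∈ t, (y : ℕ)) + 2 * ∑ i ∈ range k, i := by ring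
  rw [this, pow_add, pow_mul]
  simp

/-! ### Jacobi's complementary minor theorem -/

namespace Matrix

variable {R : Type*} [CommRing R]

theorem det_submatrix_equiv_equiv {m n : Type*} [Fintype m] [DecidableEq m] [Fintype n]
    [DecidableEq n] (e₁ e₂ : n ≃ m) (M : Matrix m m R) :
    (M.submatrix e₁ e₂).det = Equiv.Perm.sign (e₂.symm.trans e₁) * M.det := by
  have := det_reindex e₁.symm e₂.symm M
  simpa [reindex_apply] using this

/-- Complementary minors of a block matrix and its inverse. -/
theorem det_toBlocks₁₁_eq_of_mul_eq_one {m n : Type*} [Fintype m] [DecidableEq m] [Fintype n]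
    [DecidableEq n] {M N : Matrix (m ⊕ n) (m ⊕ n) R} (h : M * N = 1) :
    M.toBlocks₁₁.det = M.det * N.toBlocks₂₂.det := by
  -- Replacing the first block column of N by that of the identity makes both this factor and the
  -- product block triangular, so determinants can be compared.
  have h1 : M * fromBlocks 1 N.toBlocks₁₂ 0 N.toBlocks₂₂ =
      fromBlocks M.toBlocks₁₁ 0 M.toBlocks₂₁ 1 := by
    have h2 := h
    rw [← fromBlocks_toBlocks M, ← fromBlocks_toBlocks N, fromBlocks_multiply,
      ← fromBlocks_one, fromBlocks_inj] at h2
    conv_lhs => rw [← fromBlocks_toBlocks M]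
    rw [fromBlocks_multiply, h2.2.1, h2.2.2.2]
    simp
  have h3 := congrArg det h1
  rw [det_mul, det_fromBlocks_zero₂₁, det_fromBlocks_zero₁₂, det_one, det_one, one_mul,
    mul_one] at h3
  exact h3.symm

/-- Jacobi's theorem on complementary minors of an inverse matrix. -/
theorem det_submatrix_orderEmbOfFin_eq_of_mul_eq_one {m k l : ℕ} {M N : Matrix (Fin m) (Fin m) R}
    (h : M * N = 1) (s t : Finset (Fin m)) (hs : #s = k) (hsc : #sᶜ = l) (ht : #t = k)
    (htc : #tᶜ = l) :
    (M.submatrix (s.orderEmbOfFin hs) (t.orderEmbOfFin ht)).det =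
      (-1) ^ (∑ y ∈ s, (y : ℕ) + ∑ y ∈ t, (y : ℕ)) * M.det *
        (N.submatrix (tᶜ.orderEmbOfFin htc) (sᶜ.orderEmbOfFin hsc)).det := by
  set e := finSumEquivOfFinset hs hsc
  set f := finSumEquivOfFinset ht htc
  have h1 : M.submatrix e f * N.submatrix f e = 1 := by
    rw [submatrix_mul_equiv, h, submatrix_one_equiv]
  have h2 := det_toBlocks₁₁_eq_of_mul_eq_one h1
  rw [det_submatrix_equiv_equiv, Equiv.Perm.sign_finSumEquivOfFinset] at h2
  push_cast at h2
  have h3 : (M.submatrix e f).toBlocks₁₁ =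
      M.submatrix (s.orderEmbOfFin hs) (t.orderEmbOfFin ht) := by
    ext i j
    simp [toBlocks₁₁, e, f]
  have h4 : (N.submatrix f e).toBlocks₂₂ =
      N.submatrix (tᶜ.orderEmbOfFin htc) (sᶜ.orderEmbOfFin hsc) := by
    ext i j
    simp [toBlocks₂₂, e, f]
  rwa [h3, h4] at h2

end Matrix

/-! ### Recursions for complete and elementary symmetric polynomials -/

namespace MvPolynomial

variable (R : Type*) [CommRing R]

theorem hsymm_option {σ : Type*} [Fintype σ] [DecidableEq σ] (d : ℕ) :
    hsymm (Option σ) R (d + 1) =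
      X none * hsymm (Option σ) R d + rename some (hsymm σ R (d + 1)) := by
  rw [hsymm, ← Equiv.sum_comp (symOptionSuccEquiv (α := σ) (n := d)).symm,
    Fintype.sum_sum_type]
  congr 1
  · rw [hsymm, mul_sum]
    refine Fintype.sum_congr _ _ fun s => ?_
    change (((SymOptionSuccEquiv.decode (Sum.inl s)).1).map X).prod = _
    change (Multiset.map X (none ::ₘ s.1)).prod = _
    rw [Multiset.map_cons, Multiset.prod_cons]
  · rw [hsymm, map_sum]
    refine Fintype.sum_congr _ _ fun s => ?_
    change (((SymOptionSuccEquiv.decode (Sum.inr s)).1).map X).prod = _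
    simp only [SymOptionSuccEquiv.decode]
    rw [← Multiset.prod_hom, Multiset.map_map]
    simp [Sym.map, Multiset.map_map, Function.comp_def]

end MvPolynomial

namespace DetDuality

open MvPolynomial

variable (R : Type*) [CommRing R]

theorem h_natCast (d p q : ℕ) : h R d p q =
    rename (fun j : Ioc p q => (j : ℕ)) (hsymm (Ioc p q) R d) := by
  simp [h]

theorem h_zero (p q : ℕ) : h R 0 p q = 1 := by
  simp [h]

theorem h_succ_of_le {p q : ℕ} (hpq : q ≤ p) (d : ℕ) : h R (d + 1 : ℕ) p q = 0 := by
  have : IsEmpty (Ioc p q) := by rw [Ioc_eq_empty_of_le hpq]; infer_instance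
  rw [h_natCast, hsymm, Fintype.sum_empty, map_zero]

theorem h_succ_of_lt {p q : ℕ} (hpq : p < q) (d : ℕ) :
    h R (d + 1 : ℕ) p q = X (p + 1) * h R d p q + h R (d + 1 : ℕ) (p + 1) q := by
  let f : Option (Ioc (p + 1) q) ≃ Ioc p q :=
    { toFun := fun o => o.elim ⟨p + 1, by simp; omega⟩
        fun j => ⟨j, by have := j.2; simp only [mem_Ioc] at this ⊢; omega⟩
      invFun := fun j => if hj : (j : ℕ) = p + 1 then none
        else some ⟨j, by have := j.2; simp only [mem_Ioc] at this ⊢; omega⟩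
      left_inv := by
        rintro (_ | j)
        · simp
        · have := j.2
          simp only [mem_Ioc] at this
          have h' : (j : ℕ) ≠ p + 1 := by omega
          simp [h']
      right_inv := by
        intro j
        by_cases hj : (j : ℕ) = p + 1
        · simp only [hj, dite_true]; ext; simp [hj]
        · simp [hj] }
  simp only [h_natCast]
  rw [← rename_hsymm _ R _ f, ← rename_hsymm _ R _ f, hsymm_option]
  simp only [map_add, map_mul, rename_rename, rename_X]
  rfl

/-- Monomials are sorted by their smallest variable x_v, which may recur: hence the lower bound v -
1, against v in `e_succ`. -/
theorem h_succ (d p q : ℕ) :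
    h R (d + 1 : ℕ) p q = ∑ v ∈ Ioc p q, X v * h R d (v - 1) q := by
  by_cases hpq : q ≤ p
  · rw [h_succ_of_le R hpq, Ioc_eq_empty_of_le hpq, sum_empty]
  · obtain ⟨k, rfl⟩ : ∃ k, q = p + k := ⟨q - p, by omega⟩
    clear hpq
    induction k generalizing p with
    | zero => rw [h_succ_of_le R (by omega)]; simp
    | succ k ih =>
      have h1 : Ioc p (p + (k + 1)) = insert (p + 1) (Ioc (p + 1) (p + 1 + k)) := by
        ext x; simp only [mem_Ioc, mem_insert]; omega
      rw [h_succ_of_lt R (by omega), h1, sum_insert (by simp), add_tsub_cancel_right,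
        show p + (k + 1) = p + 1 + k by omega, ih]

theorem e_natCast (d p q : ℕ) :
    e R d p q = ∑ t ∈ powersetCard d (Ioc p q), ∏ i ∈ t, X i := by
  have h1 : (univ : Finset (Ioc p q)).map (Function.Embedding.subtype _) = Ioc p q := attach_map_val
  simp only [e, esymm]
  rw [if_neg (by omega), map_sum, Int.toNat_natCast]
  conv_rhs => rw [← h1, powersetCard_map, sum_map]
  simp only [RelEmbedding.coe_toEmbedding, mapEmbedding_apply, prod_map, map_prod, rename_X]
  rfl

theorem e_zero (p q : ℕ) : e R 0 p q = 1 := by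
  simp [e]

theorem e_eq_zero {d p q : ℕ} (hd : q < p + d) (hd0 : d ≠ 0) : e R d p q = 0 := by
  rw [e_natCast, powersetCard_eq_empty.2 (by rw [Nat.card_Ioc]; omega), sum_empty]

theorem e_succ_of_lt {p q : ℕ} (hpq : p < q) (d : ℕ) :
    e R (d + 1 : ℕ) p q = X (p + 1) * e R d (p + 1) q + e R (d + 1 : ℕ) (p + 1) q := by
  have h1 : Ioc p q = insert (p + 1) (Ioc (p + 1) q) := by
    ext x; simp only [mem_Ioc, mem_insert]; omega
  have h2 : p + 1 ∉ Ioc (p + 1) q := by simp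
  have h3 : ∀ t ∈ powersetCard d (Ioc (p + 1) q), p + 1 ∉ t :=
    fun t ht hp => h2 ((mem_powersetCard.1 ht).1 hp)
  simp only [e_natCast]
  rw [h1, powersetCard_succ_insert h2, sum_union, add_comm, sum_image, mul_sum]
  · congr 1
    refine sum_congr rfl fun t ht => ?_
    rw [prod_insert (h3 t ht)]
  · intro s hs t ht hst
    rw [← erase_insert (h3 s hs), ← erase_insert (h3 t ht), hst]
  · rw [disjoint_left]
    intro t ht ht'
    obtain ⟨s, -, rfl⟩ := mem_image.1 ht'
    exact h2 ((mem_powersetCard.1 ht).1 (mem_insert_self _ _))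

theorem e_succ (d p q : ℕ) :
    e R (d + 1 : ℕ) p q = ∑ v ∈ Ioc p q, X v * e R d v q := by
  by_cases hpq : q ≤ p
  · rw [e_eq_zero R (by omega) (by omega), Ioc_eq_empty_of_le hpq, sum_empty]
  · obtain ⟨k, rfl⟩ : ∃ k, q = p + k := ⟨q - p, by omega⟩
    clear hpq
    induction k generalizing p with
    | zero => rw [e_eq_zero R (by omega) (by omega)]; simp
    | succ k ih =>
      have h1 : Ioc p (p + (k + 1)) = insert (p + 1) (Ioc (p + 1) (p + 1 + k)) := by
        ext x; simp only [mem_Ioc, mem_insert]; omega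
      rw [e_succ_of_lt R (by omega), h1, sum_insert (by simp),
        show p + (k + 1) = p + 1 + k by omega, ih]

end DetDuality

namespace DetDuality

/-! ### Strict and weak sequence sums and their telescoping -/

section PathSums

variable {S : Type*} [CommRing S] (N : ℕ) (w : ℕ → ℕ → S)

/-- The sum of `∏ w (i + r) (t r)` over sequences `t 1 > t 2 > ⋯ > t k > v` with values
less than `N`. -/
def strictSum (i : ℕ) : ℕ → ℕ → S
  | 0, _ => 1
  | k + 1, v => ∑ u ∈ range N with v < u, w (i + k + 1) u * strictSum i k u

/-- The sum of `∏ w (j + r) (t r)` over sequences `v ≤ t 1 ≤ t 2 ≤ ⋯ ≤ t k` with values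
less than `N`. -/
def weakSum : ℕ → ℕ → ℕ → S
  | _, 0, _ => 1
  | j, k + 1, v => ∑ u ∈ range N with v ≤ u, w (j + 1) u * weakSum (j + 1) k u

/-- The sum over sequences of length `d` whose first `k + 1` terms strictly decrease and whose
last `d - k` terms weakly increase. -/
def valleySum (i d k : ℕ) : S :=
  ∑ v ∈ range N, strictSum N w i k v * (w (i + k + 1) v * weakSum N w (i + k + 1) (d - k - 1) v)

variable {N w}

theorem weakSum_succ_zero (j k : ℕ) :
    weakSum N w j (k + 1) 0 = ∑ u ∈ range N, w (j + 1) u * weakSum N w (j + 1) k u := by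
  simp [weakSum]

theorem strictSum_succ_zero (hw : ∀ r, w r 0 = 0) (i k : ℕ) :
    strictSum N w i (k + 1) 0 = ∑ u ∈ range N, w (i + k + 1) u * strictSum N w i k u := by
  rw [strictSum]
  refine sum_subset (filter_subset _ _) fun u hu hu' => ?_
  obtain rfl : u = 0 := by
    by_contra h
    exact hu' (mem_filter.2 ⟨hu, Nat.pos_of_ne_zero h⟩)
  rw [hw, zero_mul]

/-- Compare the last strict term v with the first weak term u. If v ≤ u, the valley bottom is v; if
u < v, the term u extends the decreasing part and is the bottom. -/
theorem strictSum_mul_weakSum (hw : ∀ r, w r 0 = 0) {i d k : ℕ} (hk : k + 1 < d) :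
    strictSum N w i (k + 1) 0 * weakSum N w (i + (k + 1)) (d - (k + 1)) 0 =
      valleySum N w i d (k + 1) + valleySum N w i d k := by
  obtain ⟨m, rfl⟩ : ∃ m, d = m + (k + 1) + 1 := ⟨d - (k + 2), by omega⟩
  have e1 : m + (k + 1) + 1 - (k + 1) = m + 1 := by omega
  have e2 : m + (k + 1) + 1 - k - 1 = m + 1 := by omega
  rw [e1, strictSum_succ_zero hw, weakSum_succ_zero, sum_mul_sum, valleySum, valleySum, e1, e2]
  simp only [add_tsub_cancel_right, strictSum, weakSum, sum_filter, sum_mul, mul_sum]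
  rw [sum_comm (s := range N) (t := range N)]
  conv_rhs => arg 2; rw [sum_comm]
  rw [← sum_add_distrib]
  refine sum_congr rfl fun v _ => ?_
  rw [← sum_add_distrib]
  refine sum_congr rfl fun u _ => ?_
  simp only [← add_assoc]
  by_cases h : v < u
  · simp [h, h.not_ge]
  · simp [h, not_lt.1 h]
    ring

/-- Interior terms are sums of two consecutive valley sums, and the two end terms are single valley
sums, so the alternating sum telescopes to zero. -/
theorem sum_strictSum_mul_weakSum (hw : ∀ r, w r 0 = 0) (i d : ℕ) :
    ∑ k ∈ range (d + 2), (-1) ^ k *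
      (strictSum N w i k 0 * weakSum N w (i + k) (d + 1 - k) 0) = 0 := by
  have key : ∀ m ≤ d, ∑ k ∈ range (m + 1), (-1) ^ k *
      (strictSum N w i k 0 * weakSum N w (i + k) (d + 1 - k) 0) =
        (-1) ^ m * valleySum N w i (d + 1) m := by
    intro m hm
    induction m with
    | zero => simp [strictSum, weakSum_succ_zero, valleySum]
    | succ m ih =>
      rw [sum_range_succ, ih (by omega), strictSum_mul_weakSum hw (by omega)]
      ring
  rw [sum_range_succ, key d le_rfl, strictSum_succ_zero hw, valleySum]
  simp only [add_tsub_cancel_left, tsub_self, weakSum, mul_one]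
  rw [pow_succ, mul_neg_one, neg_mul, ← sub_eq_add_neg, sub_eq_zero]
  simp only [mul_comm]

end PathSums

/-! ### Evaluating the sequence sums for the rows of β/α -/

section Weights

open MvPolynomial

variable (R : Type*) [CommRing R] (α β : ℕ → ℕ)

/-- The variable `x_u` when row `r` of the skew diagram `β/α` may contain the entry `u`. -/
noncomputable def rowWeight (r u : ℕ) : MvPolynomial ℕ R :=
  if u ∈ Ioc (α r) (β r) then X u else 0

theorem rowWeight_zero (r : ℕ) : rowWeight R α β r 0 = 0 := by
  simp [rowWeight]

variable {R α β} {n N : ℕ}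

/-- As α decreases, the first term's lower bound implies all later ones; as β decreases, the last
upper bound implies all earlier ones. A first term above the last upper bound leaves a
positive-degree `h` on an empty list, which is zero. -/
theorem weakSum_eq_h (hα : IsPartition n α) (hβ : IsPartition n β)
    (hN : ∀ r, 1 ≤ r → r ≤ n → β r < N) (k j v : ℕ) (hjk : j + (k + 1) ≤ n) :
    weakSum N (rowWeight R α β) j (k + 1) v =
      h R (k + 1 : ℕ) (max (α (j + 1)) (v - 1)) (β (j + (k + 1))) := by
  induction k generalizing j v with
  | zero =>
    rw [h_succ, weakSum]
    simp only [weakSum, mul_one, Nat.cast_zero, h_zero, rowWeight, zero_add]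
    rw [← sum_filter]
    refine sum_congr ?_ fun _ _ => rfl
    ext u
    have := hN (j + 1) (by omega) hjk
    simp only [mem_filter, mem_range, mem_Ioc]
    omega
  | succ k ih =>
    rw [h_succ, weakSum]
    have hle : β (j + (k + 1 + 1)) ≤ β (j + 1) := hβ _ _ (by omega) (by omega) hjk
    have hle' : α (j + 1 + 1) ≤ α (j + 1) := hα _ _ (by omega) (by omega) (by omega)
    have hNj := hN (j + 1) (by omega) (by omega)
    have e1 : j + 1 + (k + 1) = j + (k + 1 + 1) := by omega
    symm
    refine sum_subset_zero_on_sdiff ?_ ?_ ?_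
    · intro u
      simp only [mem_filter, mem_range, mem_Ioc]
      omega
    · intro u hu
      simp only [mem_sdiff, mem_filter, mem_range, mem_Ioc] at hu
      rw [rowWeight]
      split_ifs with hu'
      · rw [mem_Ioc] at hu'
        rw [ih _ _ (by omega), e1, h_succ_of_le _ (by omega), mul_zero]
      · rw [zero_mul]
    · intro u hu
      rw [mem_Ioc] at hu
      rw [rowWeight, if_pos (by rw [mem_Ioc]; omega), ih _ _ (by omega), e1,
        max_eq_right (by omega)]

theorem weakSum_zero_eq_h (hα : IsPartition n α) (hβ : IsPartition n β)
    (hN : ∀ r, 1 ≤ r → r ≤ n → β r < N) (k j : ℕ) (hjk : j + k ≤ n) :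
    weakSum N (rowWeight R α β) j k 0 = h R k (α (j + 1)) (β (j + k)) := by
  cases k with
  | zero => simp [weakSum, h_zero]
  | succ k => rw [weakSum_eq_h hα hβ hN k j 0 hjk]; simp

/-- A strictly decreasing sequence starting at most at β_{i+1} and staying above v has at most
β_{i+1} - v terms. -/
theorem strictSum_eq_zero (k i v : ℕ)
    (hv : β (i + 1) ≤ v + k) : strictSum N (rowWeight R α β) i (k + 1) v = 0 := by
  induction k generalizing v with
  | zero =>
    rw [strictSum]
    refine sum_eq_zero fun u hu => ?_
    rw [mem_filter] at hu
    rw [rowWeight, if_neg, zero_mul]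
    rw [mem_Ioc]
    simp only [add_zero]
    omega
  | succ k ih =>
    rw [strictSum]
    refine sum_eq_zero fun u hu => ?_
    rw [mem_filter] at hu
    rw [ih _ (by omega), mul_zero]

/-- The parallelogram inequalities make the row bounds automatic for strict sequences within the
outer bounds. The hypothesis on v leaves room for the j - i - k terms of later rows between α_j and
v, which is what the induction needs. -/
theorem strictSum_eq_e_of_forall {i j : ℕ}
    (hN : ∀ r, 1 ≤ r → r ≤ n → β r < N) (hj : j ≤ n)
    (hα : ∀ r, i + 1 ≤ r → r ≤ j → α r + r ≤ α j + j)
    (hβ : ∀ r, i + 1 ≤ r → r ≤ j → β (i + 1) + (i + 1) ≤ β r + r)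
    (hβ' : IsPartition n β) (k v : ℕ) (hk : i + k ≤ j) (hv : α j + j ≤ v + (i + k)) :
    strictSum N (rowWeight R α β) i k v = e R k v (β (i + 1)) := by
  induction k generalizing v with
  | zero => simp [strictSum, e_zero]
  | succ k ih =>
    rw [strictSum, e_succ]
    have hα' := hα (i + k + 1) (by omega) (by omega)
    have hβ'' := hβ (i + k + 1) (by omega) (by omega)
    have hle : β (i + k + 1) ≤ β (i + 1) := hβ' _ _ (by omega) (by omega) (by omega)
    have hNk := hN (i + k + 1) (by omega) (by omega)
    have hN1 := hN (i + 1) (by omega) (by omega)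
    refine (sum_congr_of_eq_on_inter ?_ ?_ ?_)
    · intro u hu hu'
      rw [mem_filter, mem_range] at hu
      rw [mem_Ioc] at hu'
      rw [rowWeight, if_neg (by rw [mem_Ioc]; omega), zero_mul]
    · intro u hu hu'
      rw [mem_Ioc] at hu
      exact absurd (mem_filter.2 ⟨mem_range.2 (by omega), hu.1⟩) hu'
    · intro u hu hu'
      rw [mem_Ioc] at hu'
      rw [ih u (by omega) (by omega), rowWeight]
      split_ifs with h
      · rfl
      · rw [mem_Ioc] at h
        -- Here u exceeds the upper bound of row i+k+1, so fewer than k variables remain above u and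
        -- `e` vanishes. For k = 0 that bound is β_{i+1} itself, so this case cannot occur.
        have hk0 : k ≠ 0 := by
          rintro rfl
          simp only [add_zero] at *
          omega
        rw [e_eq_zero _ (by omega) hk0, mul_zero, mul_zero]

theorem strictSum_eq_e (hβ : IsPartition n β) (hN : ∀ r, 1 ≤ r → r ≤ n → β r < N)
    {i k : ℕ} (hik : i + (k + 1) ≤ n) (hpar : ParallelogramCondition α β (i + (k + 1)) i) :
    strictSum N (rowWeight R α β) i (k + 1) 0 =
      e R (k + 1 : ℕ) (α (i + (k + 1))) (β (i + 1)) := by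
  -- The last term lies in row i+k+1, so its weight already forces it above α_{i+k+1}.
  have h0 : strictSum N (rowWeight R α β) i (k + 1) 0 =
      strictSum N (rowWeight R α β) i (k + 1) (α (i + (k + 1))) := by
    rw [strictSum, strictSum]
    symm
    refine sum_subset (fun u => ?_) fun u hu hu' => ?_
    · simp only [mem_filter]
      exact fun h => ⟨h.1, h.2.pos⟩
    · rw [rowWeight, if_neg, zero_mul]
      intro h
      rw [mem_filter] at hu hu'
      rw [mem_Ioc, add_assoc] at h
      exact hu' ⟨hu.1, h.1⟩
  rw [h0]
  rcases hpar with h | h | h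
  · push_cast at h
    omega
  · push_cast at h
    rw [strictSum_eq_zero _ _ _ (by omega), e_eq_zero _ (by omega) (by omega)]
  · refine strictSum_eq_e_of_forall hN hik (fun r h1 h2 => ?_) (fun r h1 h2 => ?_) hβ _ _
      le_rfl le_rfl
    · have := (h r h1 h2).1
      push_cast at this
      omega
    · have := (h r h1 h2).2
      omega

end Weights

end DetDuality

/-! ### The unitriangular matrix and its inverse -/

namespace DetDuality

open MvPolynomial

variable (R : Type*) [CommRing R] (n N : ℕ) (α β : ℕ → ℕ)

/-- The matrix of complete homogeneous symmetric polynomials indexed by all of `{0, …, n}`. -/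
noncomputable def hMatrix : Matrix (Fin (n + 1)) (Fin (n + 1)) (MvPolynomial ℕ R) :=
  Matrix.of fun a b => h R ((b : ℤ) - (a : ℤ)) (α (a + 1)) (β b)

/-- The inverse of `hMatrix` up to the signs `(-1) ^ (i + j)`. -/
noncomputable def strictMatrix : Matrix (Fin (n + 1)) (Fin (n + 1)) (MvPolynomial ℕ R) :=
  Matrix.of fun i j =>
    if i ≤ j then strictSum N (rowWeight R α β) i (j - i) 0 else 0

variable {R n N α β}

theorem h_of_neg {d : ℤ} (hd : d < 0) (p q : ℕ) : h R d p q = 0 := if_pos hd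

theorem e_of_neg {d : ℤ} (hd : d < 0) (p q : ℕ) : e R d p q = 0 := if_pos hd

theorem det_hMatrix : (hMatrix R n α β).det = 1 := by
  rw [Matrix.det_of_isUpperTriangular]
  · simp [hMatrix, h_zero]
  · intro i j hij
    simp only [id_eq, Fin.lt_def] at hij
    exact h_of_neg (by omega) _ _

theorem strictMatrix_mul_hMatrix (hα : IsPartition n α) (hβ : IsPartition n β)
    (hN : ∀ r, 1 ≤ r → r ≤ n → β r < N) :
    (Matrix.of fun i j : Fin (n + 1) =>
      (-1) ^ (i : ℕ) * ((-1) ^ (j : ℕ) * strictMatrix R n N α β i j)) * hMatrix R n α β = 1 := by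
  ext1 i l
  rw [Matrix.mul_apply]
  set g : ℕ → MvPolynomial ℕ R := fun j => (-1) ^ (i : ℕ) * ((-1) ^ j *
    (if (i : ℕ) ≤ j then strictSum N (rowWeight R α β) i (j - i) 0 else 0)) *
      h R ((l : ℤ) - (j : ℤ)) (α (j + 1)) (β l) with hg
  have h1 : ∀ j : Fin (n + 1), (Matrix.of fun i j : Fin (n + 1) =>
      (-1) ^ (i : ℕ) * ((-1) ^ (j : ℕ) * strictMatrix R n N α β i j)) i j *
        hMatrix R n α β j l = g j := fun j => by
    simp only [hg, strictMatrix, hMatrix, Matrix.of_apply, Fin.le_def]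
  rw [Fintype.sum_congr _ _ h1, Fin.sum_univ_eq_sum_range g]
  have hi := i.2
  have hl := l.2
  have hsub : Icc (i : ℕ) l ⊆ range (n + 1) := fun x => by
    simp only [mem_Icc, mem_range]; omega
  -- Both factors are upper triangular, so only i ≤ j ≤ l contributes.
  have h2 : ∑ j ∈ range (n + 1), g j = ∑ j ∈ Icc (i : ℕ) l, g j := by
    refine (sum_subset hsub fun x _ hx => ?_).symm
    simp only [mem_Icc, not_and_or, not_le] at hx
    rcases hx with hx | hx
    · simp [hg, hx.not_ge]
    · simp only [hg]
      rw [h_of_neg (by omega), mul_zero]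
  rw [h2]
  rcases lt_trichotomy i l with hil | rfl | hil
  · rw [Matrix.one_apply_ne hil.ne]
    obtain ⟨d, hd⟩ : ∃ d, (l : ℕ) = i + d + 1 := ⟨l - i - 1, by have := Fin.lt_def.1 hil; omega⟩
    rw [← sum_strictSum_mul_weakSum (N := N) (w := rowWeight R α β) (rowWeight_zero R α β) i d,
      ← Ico_add_one_right_eq_Icc, sum_Ico_eq_sum_range,
      show (l : ℕ) + 1 - i = d + 2 by omega]
    refine sum_congr rfl fun k hk => ?_
    rw [mem_range] at hk
    have h3 : ((l : ℕ) : ℤ) - ((i + k : ℕ) : ℤ) = (d + 1 - k : ℕ) := by omega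
    simp only [hg]
    rw [if_pos (by omega), add_tsub_cancel_left, h3,
      weakSum_zero_eq_h hα hβ hN _ _ (by omega), show (i : ℕ) + k + (d + 1 - k) = l by omega,
      pow_add]
    have h4 : ((-1 : MvPolynomial ℕ R) ^ (i : ℕ)) * (-1) ^ (i : ℕ) = 1 := by
      rw [← mul_pow]; simp
    linear_combination ((-1) ^ k * strictSum N (rowWeight R α β) i k 0 *
      h R (d + 1 - k : ℕ) (α (i + k + 1)) (β l)) * h4
  · simp [hg, strictSum, h_zero, ← mul_pow]
  · rw [Matrix.one_apply_ne hil.ne', Icc_eq_empty (by simpa using hil), sum_empty]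

theorem strictMatrix_eq_e (hβ : IsPartition n β) (hN : ∀ r, 1 ≤ r → r ≤ n → β r < N)
    {i j : Fin (n + 1)} (hpar : ParallelogramCondition α β j i) :
    strictMatrix R n N α β i j = e R ((j : ℤ) - (i : ℤ)) (α j) (β (i + 1)) := by
  simp only [strictMatrix, Matrix.of_apply]
  rcases lt_trichotomy i j with hij | rfl | hij
  · obtain ⟨k, hk⟩ : ∃ k, (j : ℕ) = i + (k + 1) :=
      ⟨j - i - 1, by have := Fin.lt_def.1 hij; omega⟩
    have hj := j.2
    rw [if_pos hij.le, show (j : ℕ) - i = k + 1 by omega,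
      show ((j : ℕ) : ℤ) - (i : ℕ) = (k + 1 : ℕ) by omega, hk]
    exact strictSum_eq_e hβ hN (by omega) (hk ▸ hpar)
  · simp [strictSum, e_zero]
  · rw [if_neg hij.not_ge, e_of_neg (by have := Fin.lt_def.1 hij; omega)]

end DetDuality

end

/-! ### The duality of determinants -/

theorem theorem2p8 {R : Type*} [CommRing R] (n : ℕ)
    (A B : Finset (Fin (n + 1))) (hAB : A.card = B.card)
    (α β : ℕ → ℕ)
    (hα : DetDuality.IsPartition n α) (hβ : DetDuality.IsPartition n β)
    (hαβ : ∀ i : ℕ, 1 ≤ i → i ≤ n → α i ≤ β i)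
    (hpar : ∀ a' ∈ Aᶜ, ∀ b' ∈ Bᶜ, DetDuality.ParallelogramCondition α β (a' : ℕ) (b' : ℕ)) :
    (DetDuality.matrixOn A B hAB
        (fun a b => DetDuality.h R ((b : ℤ) - (a : ℤ)) (α (a + 1)) (β b))).det =
      (DetDuality.matrixOn Aᶜ Bᶜ (DetDuality.card_compl_eq hAB)
        (fun a' b' => DetDuality.e R ((a' : ℤ) - (b' : ℤ)) (α a') (β (b' + 1)))).det := by
  -- Since β_1 is the largest part, cutting the sums off at β_1 + 1 loses no variable.
  have hN : ∀ r, 1 ≤ r → r ≤ n → β r < β 1 + 1 := fun r h1 h2 =>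
    Nat.lt_succ_of_le (hβ 1 r le_rfl h1 h2)
  have hinv := mul_eq_one_comm.1
    (DetDuality.strictMatrix_mul_hMatrix (R := R) (N := β 1 + 1) hα hβ hN)
  have hcard := DetDuality.card_compl_eq hAB
  have hJ := Matrix.det_submatrix_orderEmbOfFin_eq_of_mul_eq_one hinv A B rfl rfl hAB.symm
    hcard.symm
  rw [DetDuality.det_hMatrix, mul_one] at hJ
  refine hJ.trans ?_
  rw [← Matrix.det_transpose]
  set E := DetDuality.matrixOn Aᶜ Bᶜ hcard
    (fun a' b' => DetDuality.e R ((a' : ℤ) - (b' : ℤ)) (α a') (β (b' + 1))) with hE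
  set s : ℕ → MvPolynomial ℕ R := fun i => (-1) ^ i
  have hS : ∀ (C : Finset (Fin (n + 1))) {k : ℕ} (hC : C.card = k),
      ∏ i, s (C.orderEmbOfFin hC i) = (-1) ^ ∑ y ∈ C, (y : ℕ) := by
    intro C k hC
    rw [Finset.prod_pow_eq_pow_sum]
    congr 1
    conv_rhs => rw [← C.map_orderEmbOfFin_univ hC, Finset.sum_map]
    rfl
  -- Jacobi gives rows B^c and columns A^c; transposing restores the required order, and the signs
  -- become row and column factors.
  have hsub : (Matrix.submatrix (Matrix.of fun i j : Fin (n + 1) => (-1) ^ (i : ℕ) *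
      ((-1) ^ (j : ℕ) * DetDuality.strictMatrix R n (β 1 + 1) α β i j))
        (Bᶜ.orderEmbOfFin hcard.symm) (Aᶜ.orderEmbOfFin rfl)).transpose =
      Matrix.of fun i j => s (Bᶜ.orderEmbOfFin hcard.symm j) *
        (Matrix.of fun i j => s (Aᶜ.orderEmbOfFin rfl i) * E i j) i j := by
    ext1 i j
    simp only [Matrix.transpose_apply, Matrix.submatrix_apply, Matrix.of_apply]
    rw [DetDuality.strictMatrix_eq_e hβ hN (hpar _ (Finset.orderEmbOfFin_mem _ _ _) _
      (Finset.orderEmbOfFin_mem _ _ _))]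
    rfl
  rw [hsub, Matrix.det_mul_row, Matrix.det_mul_column, hS, hS, ← mul_assoc, ← mul_assoc,
    ← pow_add, ← pow_add]
  have htot : ∑ y ∈ A, (y : ℕ) + ∑ y ∈ B, (y : ℕ) + ∑ y ∈ Bᶜ, (y : ℕ) + ∑ y ∈ Aᶜ, (y : ℕ) =
      2 * ∑ y : Fin (n + 1), (y : ℕ) := by
    rw [two_mul]
    nth_rewrite 1 [← Finset.sum_add_sum_compl A]
    rw [← Finset.sum_add_sum_compl B]
    ring
  rw [htot, pow_mul]
  simp
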